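/- Let $P_k$ be the path with $k$ vertices, and let $E$ be the six-vertex graph obtained from the claw $K_{1,3}$ by subdividing each of two of its edges once. In the game of Cops and Robbers on a connected graph $G$, the cops first choose their vertices (several cops may share a vertex), then the robber chooses a vertex; after that the two players alternate, cops first, and in a turn each piece of the player either moves to an adjacent vertex or stays. The cops win if after finitely many moves a cop is on the vertex of the robber. The cop number $c(G)$ is the least number of cops that have a strategy that wins against every play of the robber. Theorem. Let $k \ge 0$ be an integer and let $G$ be a connected simple graph (finite or infinite) such that no induced subgraph of $G$ is isomorphic to $P_k$ or to $E$. Then $$c(G) \le \Big\lceil \frac{k-1}{2} \Big\rceil + 3.$$ -/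

import Mathlib

namespace CopsRobbers

/-- A legal turn of a single piece: it moves to an adjacent vertex or stays where it is. -/
def Step {V : Type*} (G : SimpleGraph V) (u v : V) : Prop := v = u ∨ G.Adj u v

/-- `CopsWinFrom G c r`: with the `n` cops on the vertices `c 0, …, c (n - 1)`, the robber on `r` and
the cops to move, the cops can force a capture after finitely many moves.
Being an inductive predicate, it is the least one closed under the two rules, so a derivation
is a strategy of the cops that ends every play after finitely many moves.
Several cops may share a vertex, and both players have full information. -/
inductive CopsWinFrom {V : Type*} (G : SimpleGraph V) {n : ℕ} : (Fin n → V) → V → Prop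
  /-- The cops make a move after which some cop is on the vertex of the robber. -/
  | capture (c c' : Fin n → V) (r : V) (hc : ∀ i, Step G (c i) (c' i)) (i : Fin n)
      (hi : c' i = r) : CopsWinFrom G c r
  /-- The cops make a move such that they win whatever the robber's answer is. -/
  | move (c c' : Fin n → V) (r : V) (hc : ∀ i, Step G (c i) (c' i))
      (hr : ∀ r', Step G r r' → CopsWinFrom G c' r') : CopsWinFrom G c r

/-- `n` cops have a winning strategy on `G`: they can choose initial vertices so that they win from
there, wherever the robber is placed afterwards; the cops move first. -/
def CopsWin {V : Type*} (G : SimpleGraph V) (n : ℕ) : Prop :=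
  ∃ c : Fin n → V, ∀ r : V, CopsWinFrom G c r

/-- The cop number: the least number of cops that have a winning strategy on `G`
(`⊤` if no finite number of cops suffices). -/
noncomputable def copNumber {V : Type*} (G : SimpleGraph V) : ℕ∞ :=
  ⨅ (n : ℕ) (_ : CopsWin G n), (n : ℕ∞)

/-- The graph `E`: the claw with centre `0` and leaves `1`, `3`, `5`, in which the edge from `0` to `3`
is subdivided by `2` and the edge from `0` to `5` is subdivided by `4`. -/
def graphE : SimpleGraph (Fin 6) :=
  SimpleGraph.fromEdgeSet {s(0, 1), s(0, 2), s(2, 3), s(0, 4), s(4, 5)}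

/-- `G` is `H`-free: no induced subgraph of `G` is isomorphic to `H`. -/
def IndFree {V W : Type*} (H : SimpleGraph W) (G : SimpleGraph V) : Prop :=
  ¬ H.IsIndContained G

end CopsRobbers

namespace CopsRobbers

variable {V : Type*} {G : SimpleGraph V}

/-! The cops grow an induced path `p 0, …, p m` towards the robber, who stays outside its closed
neighbourhood. By `exists_adj_guard`, cops at the even indices, at 1 and at `m` suffice to catch him
if he steps next to the path. By `exists_next` the path always extends towards him, and
`P_k`-freeness bounds its length, so the chase ends. One further cop scouts each new vertex. -/

/-- The first `m + 1` values of `p` are distinct and induce a path in `G`. -/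
def IsInducedPath (G : SimpleGraph V) (p : ℕ → V) (m : ℕ) : Prop :=
  ∀ i j, i < j → j ≤ m → p i ≠ p j ∧ (G.Adj (p i) (p j) ↔ j = i + 1)

/-- `y` is outside the closed neighbourhood of `p 0, …, p (m - 1)`. -/
def Avoids (G : SimpleGraph V) (p : ℕ → V) (m : ℕ) (y : V) : Prop :=
  ∀ i < m, y ≠ p i ∧ ¬ G.Adj (p i) y

theorem IsInducedPath.isIndContained {p : ℕ → V} {m k : ℕ} (hp : IsInducedPath G p m)
    (hk : k ≤ m + 1) : (SimpleGraph.pathGraph k).IsIndContained G := by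
  refine ⟨⟨⟨fun i => p i, fun i j hij => ?_⟩, fun {i j} => ?_⟩⟩
  · by_contra hne
    rcases lt_or_gt_of_ne (Fin.val_ne_of_ne hne) with h | h
    · exact (hp i j h (by omega)).1 hij
    · exact (hp j i h (by omega)).1 hij.symm
  · change G.Adj (p i) (p j) ↔ _
    rw [SimpleGraph.pathGraph_adj]
    rcases lt_trichotomy (i : ℕ) j with h | h | h
    · rw [(hp i j h (by omega)).2]; omega
    · rw [h]; simp
    · rw [G.adj_comm, (hp j i h (by omega)).2]; omega

theorem isIndContained_graphE {a b c d e f : V} (hab : G.Adj a b) (hac : G.Adj a c)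
    (hcd : G.Adj c d) (hae : G.Adj a e) (hef : G.Adj e f) (had : ¬ G.Adj a d) (haf : ¬ G.Adj a f)
    (hbc : ¬ G.Adj b c) (hbd : ¬ G.Adj b d) (hbe : ¬ G.Adj b e) (hbf : ¬ G.Adj b f)
    (hce : ¬ G.Adj c e) (hcf : ¬ G.Adj c f) (hde : ¬ G.Adj d e) (hdf : ¬ G.Adj d f) :
    graphE.IsIndContained G := by
  have key : ∀ i j : Fin 6, G.Adj (![a, b, c, d, e, f] i) (![a, b, c, d, e, f] j) ↔
      graphE.Adj i j := by
    intro i j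
    fin_cases i <;> fin_cases j <;>
      simp_all [graphE, G.adj_comm]
  -- No two vertices of `E` have the same neighbourhood, so a map preserving and reflecting
  -- adjacency is injective.
  have twin : ∀ i j : Fin 6, (∀ l, graphE.Adj i l ↔ graphE.Adj j l) → i = j := by
    simp only [graphE, SimpleGraph.fromEdgeSet_adj, Set.mem_insert_iff, Set.mem_singleton_iff]
    decide
  refine ⟨⟨⟨![a, b, c, d, e, f], fun i j hij => twin i j fun l => ?_⟩, fun {i j} => key i j⟩⟩
  rw [← key, ← key, hij]

/-- In an `E`-free graph, a neighbour `u` of an induced path that also has a neighbour away from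
the path is adjacent to the path at an even index, at index `1` or at the last index. -/
theorem exists_adj_guard (hE : IndFree graphE G) {p : ℕ → V} {m : ℕ} (hp : IsInducedPath G p m)
    {u w : V} (hw : Avoids G p (m + 1) w) (huw : G.Adj w u) (hu : ∃ i ≤ m, G.Adj (p i) u) :
    ∃ i ≤ m, (Even i ∨ i = 1 ∨ i = m) ∧ G.Adj (p i) u := by
  classical
  by_contra! hcon
  have hodd : ∀ i ≤ m, G.Adj (p i) u → i % 2 = 1 ∧ 3 ≤ i ∧ i < m := by
    intro i hi h
    have h1 : ¬ (Even i ∨ i = 1 ∨ i = m) := fun h2 => hcon i hi h2 h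
    rw [Nat.even_iff] at h1
    omega
  obtain ⟨i, ⟨him, hi⟩, hmin⟩ : ∃ i, (i ≤ m ∧ G.Adj (p i) u) ∧
      ∀ j < i, ¬ G.Adj (p j) u := by
    refine ⟨Nat.find hu, Nat.find_spec hu, fun j hj h => Nat.find_min hu hj ⟨?_, h⟩⟩
    exact hj.le.trans (Nat.find_spec hu).1
  obtain ⟨j, ⟨hjm, hj⟩, hmax⟩ : ∃ j, (j ≤ m ∧ G.Adj (p j) u) ∧
      ∀ l ≤ m, j < l → ¬ G.Adj (p l) u := by
    obtain ⟨j, hj⟩ := Finset.exists_max_image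
      ((Finset.range (m + 1)).filter fun l => G.Adj (p l) u) id ⟨i, by simp [hi]; omega⟩
    simp only [Finset.mem_filter, Finset.mem_range, id] at hj
    exact ⟨j, ⟨by omega, hj.1.2⟩, fun l hl hjl h => absurd (hj.2 l ⟨by omega, h⟩) (by omega)⟩
  have hio := hodd i him hi
  have hjo := hodd j hjm hj
  have hij : i ≤ j := by
    by_contra h
    exact hmin j (by omega) hj
  have adj : ∀ a, a + 1 ≤ m → G.Adj (p (a + 1)) (p a) := fun a ha =>
    ((hp a (a + 1) (by omega) ha).2.2 rfl).symm
  have nadj : ∀ a b, a + 2 ≤ b → b ≤ m → ¬ G.Adj (p a) (p b) := fun a b hab hb h => by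
    have := (hp a b (by omega) hb).2.1 h
    omega
  have nadj' : ∀ a b, a + 2 ≤ b → b ≤ m → ¬ G.Adj (p b) (p a) := fun a b hab hb h =>
    nadj a b hab hb h.symm
  have nw : ∀ a ≤ m, ¬ G.Adj (p a) w := fun a ha => (hw a (by omega)).2
  obtain ⟨l, rfl⟩ : ∃ l, i = l + 2 := ⟨i - 2, by omega⟩
  apply hE
  -- With a single neighbour on the path, `E` is centred there; otherwise it is centred at `u`, and
  -- the parity of `i` and `j` keeps its two long legs apart.
  rcases hij.eq_or_lt with rfl | hlt
  · exact isIndContained_graphE (a := p (l + 2)) (b := p (l + 3)) (c := p (l + 1)) (d := p l)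
      (e := u) (f := w) (adj (l + 2) (by omega)).symm (adj (l + 1) (by omega))
      (adj l (by omega)) hi huw.symm (nadj' _ _ (by omega) (by omega)) (nw _ (by omega))
      (nadj' _ _ (by omega) (by omega)) (nadj' _ _ (by omega) (by omega))
      (hmax _ (by omega) (by omega)) (nw _ (by omega)) (hmin _ (by omega)) (nw _ (by omega))
      (hmin _ (by omega)) (nw _ (by omega))
  · have hfar : l + 2 + 2 ≤ j := by omega
    exact isIndContained_graphE (a := u) (b := w) (c := p (l + 2)) (d := p (l + 1))
      (e := p j) (f := p (j + 1)) huw.symm hi.symm (adj (l + 1) (by omega)) hj.symm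
      (adj j (by omega)).symm (fun h => hmin (l + 1) (by omega) h.symm)
      (fun h => hmax (j + 1) (by omega) (by omega) h.symm)
      (fun h => nw _ (by omega) h.symm) (fun h => nw _ (by omega) h.symm)
      (fun h => nw _ (by omega) h.symm) (fun h => nw _ (by omega) h.symm)
      (nadj _ _ (by omega) (by omega)) (nadj _ _ (by omega) (by omega))
      (nadj _ _ (by omega) (by omega)) (nadj _ _ (by omega) (by omega))

/-- A single step of a walk all of whose later vertices are outside the closed neighbourhood of
`p 0, …, p (m - 1)`. -/
def AvoidingStep (G : SimpleGraph V) (p : ℕ → V) (m : ℕ) (a b : V) : Prop :=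
  G.Adj a b ∧ Avoids G p m b

theorem Avoids.congr {p q : ℕ → V} {m : ℕ} (h : ∀ i < m, p i = q i) {y : V}
    (hy : Avoids G p m y) : Avoids G q m y := fun i hi => h i hi ▸ hy i hi

theorem Avoids.succ {p : ℕ → V} {m : ℕ} {y : V} (hy : Avoids G p m y) (hne : y ≠ p m)
    (hadj : ¬ G.Adj (p m) y) : Avoids G p (m + 1) y := fun i hi => by
  rcases Nat.lt_succ_iff_lt_or_eq.1 hi with h | rfl
  · exact hy i h
  · exact ⟨hne, hadj⟩

/-- An avoiding walk from `p m` leaves the neighbourhood of `p m` for the last time at some `x`. -/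
theorem exists_next {p : ℕ → V} {m : ℕ} {r : V}
    (h : Relation.ReflTransGen (AvoidingStep G p m) (p m) r) :
    r = p m ∨ ∃ x, G.Adj (p m) x ∧ Avoids G p m x ∧
      Relation.ReflTransGen (AvoidingStep G p (m + 1)) x r := by
  induction h with
  | refl => exact Or.inl rfl
  | @tail b r _ hbr ih =>
    by_cases hr : r = p m
    · exact Or.inl hr
    right
    by_cases hadj : G.Adj (p m) r
    · exact ⟨r, hadj, hbr.2, .refl⟩
    rcases ih with rfl | ⟨x, hx, hxa, hxb⟩
    · exact absurd hbr.1 hadj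
    · exact ⟨x, hx, hxa, hxb.tail ⟨hbr.1, hbr.2.succ hr hadj⟩⟩

theorem IsInducedPath.update {p : ℕ → V} {m : ℕ} (hp : IsInducedPath G p m) {x : V}
    (hx : G.Adj (p m) x) (hxa : Avoids G p m x) :
    IsInducedPath G (Function.update p (m + 1) x) (m + 1) := by
  intro i j hij hj
  rw [Function.update_of_ne (by omega : i ≠ m + 1)]
  rcases hj.eq_or_lt with rfl | hlt
  · rw [Function.update_self]
    rcases (Nat.lt_succ_iff.1 hij).eq_or_lt with rfl | him
    · exact ⟨hx.ne, by simp [hx]⟩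
    · exact ⟨(hxa i him).1.symm, by simp [(hxa i him).2]; omega⟩
  · rw [Function.update_of_ne (by omega : j ≠ m + 1)]
    exact hp i j hij (by omega)

theorem copsWinFrom_of_step {n : ℕ} {c : Fin n → V} {r : V} (i : Fin n) (h : Step G (c i) r) :
    CopsWinFrom G c r := by
  classical
  refine .capture c (Function.update c i r) r (fun j => ?_) i (by simp)
  by_cases hj : j = i
  · subst hj; simpa using h
  · simp [hj, Step]

/-- If the robber moves from a vertex away from an induced path into the closed neighbourhood of
the path while cops occupy the even indices, index `1` and the last index, he is captured. -/
theorem avoids_or_copsWinFrom (hE : IndFree graphE G) {p : ℕ → V} {m : ℕ}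
    (hp : IsInducedPath G p m) {n : ℕ} {c : Fin n → V}
    (hc : ∀ i ≤ m, (Even i ∨ i = 1 ∨ i = m) → ∃ j, c j = p i) {r r' : V}
    (hr : Avoids G p (m + 1) r) (hrr' : Step G r r') :
    Avoids G p (m + 1) r' ∨ CopsWinFrom G c r' := by
  by_cases h : Avoids G p (m + 1) r'
  · exact Or.inl h
  right
  rcases hrr' with rfl | hadj
  · exact absurd hr h
  have hu : ∃ i ≤ m, G.Adj (p i) r' := by
    by_contra! hcon
    refine h fun i hi => ⟨?_, hcon i (by omega)⟩
    rintro rfl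
    exact (hr i hi).2 hadj.symm
  obtain ⟨i, him, hi, hir⟩ := exists_adj_guard hE hp hr hadj hu
  obtain ⟨j, hj⟩ := hc i him hi
  exact copsWinFrom_of_step j (Or.inr (hj ▸ hir))

/-- The cops whose final indices along the path are `T` win, once they have advanced as far as
`p m` with the robber confined beyond it; the cop `s` is the one that scouts ahead. -/
theorem copsWinFrom_of_path (hE : IndFree graphE G) {k : ℕ}
    (hP : IndFree (SimpleGraph.pathGraph k) G) {n : ℕ} {T : Fin n → ℕ} {s : Fin n}
    (hs : ∀ m, m + 1 < k → m ≤ T s)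
    (hT : ∀ m, m + 1 < k → ∀ i ≤ m, (Even i ∨ i = 1 ∨ i = m) → ∃ j, j ≠ s ∧ min (T j) m = i)
    (d : ℕ) : ∀ (m : ℕ) (p : ℕ → V) (r : V), k ≤ m + d → IsInducedPath G p m →
      Avoids G p (m + 1) r → Relation.ReflTransGen (AvoidingStep G p m) (p m) r →
      CopsWinFrom G (fun j => p (min (T j) m)) r := by
  induction d with
  | zero => exact fun m p r hk hp => absurd (hp.isIndContained (by omega)) hP
  | succ d ih =>
    intro m p r hk hp hr hreach
    rcases exists_next hreach with rfl | ⟨x, hx, hxa, hxr⟩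
    · exact absurd rfl (hr m (by omega)).1
    have hq := hp.update hx hxa
    have hqx : Function.update p (m + 1) x (m + 1) = x := Function.update_self ..
    have hqp : ∀ i ≤ m, Function.update p (m + 1) x i = p i := fun i hi =>
      Function.update_of_ne (by omega) ..
    generalize Function.update p (m + 1) x = q at hq hqx hqp
    have hmk : m + 1 + 1 < k := by
      by_contra h
      exact hP (hq.isIndContained (by omega))
    have hc : (fun j => p (min (T j) m)) = fun j => q (min (T j) m) :=
      funext fun j => (hqp _ (min_le_right _ _)).symm
    have hadv : ∀ j, Step G (q (min (T j) m)) (q (min (T j) (m + 1))) := fun j => by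
      rcases le_or_gt (T j) m with h | h
      · left; congr 1; omega
      · right
        rw [show min (T j) m = m by omega, show min (T j) (m + 1) = m + 1 by omega, hqx,
          hqp m le_rfl]
        exact hx
    have hqs : q (min (T s) (m + 1)) = x := by
      rw [min_eq_right (hs _ hmk), hqx]
    rw [hc]
    refine .move _ (fun j => if j = s then q (min (T j) (m + 1)) else q (min (T j) m)) r
      (fun j => ?_) fun r₁ hr₁ => ?_
    · split_ifs
      · exact hadv j
      · exact Or.inl rfl
    -- The scout has left `p m`, so the old path must be guarded without it.
    have hguard : ∀ i ≤ m, (Even i ∨ i = 1 ∨ i = m) →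
        ∃ j, (if j = s then q (min (T j) (m + 1)) else q (min (T j) m)) = p i := fun i him hi => by
      obtain ⟨j, hjs, hj⟩ := hT m (by omega) i him hi
      exact ⟨j, by simp [hjs, hj, hqp i him]⟩
    rcases avoids_or_copsWinFrom hE hp hguard hr hr₁ with hav | hwin
    swap
    · exact hwin
    have hreach₁ : Relation.ReflTransGen (AvoidingStep G p (m + 1)) x r₁ := by
      rcases hr₁ with rfl | hadj
      · exact hxr
      · exact hxr.tail ⟨hadj, hav⟩
    -- The scout on `x` forces the robber away from the longer path before the other cops advance,
    -- as the guarding argument needs.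
    by_cases hx₁ : Step G x r₁
    · exact copsWinFrom_of_step s (by simpa [hqs] using hx₁)
    have hav₁ : Avoids G q (m + 1 + 1) r₁ := by
      refine (hav.congr fun i hi => (hqp i (by omega)).symm).succ ?_ ?_
      · rw [hqx]; exact fun h => hx₁ (Or.inl h)
      · rw [hqx]; exact fun h => hx₁ (Or.inr h)
    have hstep : ∀ a b, AvoidingStep G p (m + 1) a b → AvoidingStep G q (m + 1) a b :=
      fun a b h => ⟨h.1, h.2.congr fun i hi => (hqp i (by omega)).symm⟩
    have hreach₂ : Relation.ReflTransGen (AvoidingStep G q (m + 1)) (q (m + 1)) r₁ := by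
      rw [hqx]; exact Relation.ReflTransGen.mono hstep _ _ hreach₁
    refine .move _ (fun j => q (min (T j) (m + 1))) r₁ (fun j => ?_) fun r₂ hr₂ => ?_
    · split_ifs
      · exact Or.inl rfl
      · exact hadv j
    have hguard₂ : ∀ i ≤ m + 1, (Even i ∨ i = 1 ∨ i = m + 1) →
        ∃ j, q (min (T j) (m + 1)) = q i := fun i him hi => by
      obtain ⟨j, -, hj⟩ := hT (m + 1) hmk i him hi
      exact ⟨j, by rw [hj]⟩
    rcases avoids_or_copsWinFrom hE hq hguard₂ hav₁ hr₂ with hav₂ | hwin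
    · refine ih (m + 1) q r₂ (by omega) hq hav₂ ?_
      rcases hr₂ with rfl | hadj
      · exact hreach₂
      · exact hreach₂.tail ⟨hadj, fun i hi => hav₂ i (by omega)⟩
    · exact hwin

theorem copsWin_of_indFree (hG : G.Connected) {k K : ℕ} (hK : k ≤ 2 * K + 1)
    (hP : IndFree (SimpleGraph.pathGraph k) G) (hE : IndFree graphE G) :
    CopsWin G (K + 3) := by
  obtain ⟨v⟩ := hG.nonempty
  refine ⟨fun _ => v, fun r => ?_⟩
  by_cases hr : Step G v r
  · exact copsWinFrom_of_step 0 hr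
  refine copsWinFrom_of_path hE hP (s := ⟨K + 1, by omega⟩)
    -- `K` cops cover the even indices, since `m + 1 < k ≤ 2 * K + 1` gives `m < 2 * K`; one stops
    -- at 1, and the last two, scout and rear guard of the tip, never stop.
    (T := fun j => if (j : ℕ) < K then 2 * j else if (j : ℕ) = K then 1 else k)
    (fun m hm => by simp; omega) (fun m hm i him hi => ?_) k 0 (fun _ => v) r (by omega)
    (fun i j hij hj => by omega) (fun i _ => ⟨fun h => hr (Or.inl h), fun h => hr (Or.inr h)⟩) ?_
  · rcases hi with ⟨l, rfl⟩ | rfl | rfl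
    · refine ⟨⟨l, by omega⟩, by simp; omega, ?_⟩
      dsimp only
      rw [if_pos (by omega)]; omega
    · exact ⟨⟨K, by omega⟩, by simp, by simp; omega⟩
    · refine ⟨⟨K + 2, by omega⟩, by simp, ?_⟩
      dsimp only
      rw [if_neg (by omega), if_neg (by omega)]; omega
  -- For `m = 0` nothing has to be avoided, so connectedness suffices.
  · exact Relation.ReflTransGen.mono (fun a b h => ⟨h, fun i hi => absurd hi (by omega)⟩) _ _
      ((SimpleGraph.reachable_iff_reflTransGen v r).1 (hG.preconnected v r))

end CopsRobbers

theorem theorem4 {V : Type*} (G : SimpleGraph V) (hG : G.Connected) (k : ℕ)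
    (hP : CopsRobbers.IndFree (SimpleGraph.pathGraph k) G)
    (hE : CopsRobbers.IndFree CopsRobbers.graphE G) :
    CopsRobbers.copNumber G ≤ ((⌈((k : ℝ) - 1) / 2⌉₊ + 3 : ℕ) : ℕ∞) := by
  refine iInf₂_le _ (CopsRobbers.copsWin_of_indFree hG ?_ hP hE)
  have h := Nat.le_ceil (((k : ℝ) - 1) / 2)
  have : (k : ℝ) ≤ 2 * (⌈((k : ℝ) - 1) / 2⌉₊ : ℝ) + 1 := by linarith
  exact_mod_cast this
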